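/- Let $G$ be a finite simple graph with vertex set $V(G)=\{x,y,v_1,\dots,v_n\}$ (these $n+2$ vertices being distinct) that is a $2$-connected outerplane near-triangulation; that is, $G$ has at least three vertices, is connected and has no cutvertex, and it is embedded in the plane so that every vertex lies on the boundary of the outer face and every face except possibly the outer one is a triangle. Let $C\colon V(G)\to\{1,2,3\}$ be any proper $3$-colouring of $G$. Let $P(G)=\prod_{uv\in E(G),\,u<v}(u-v)$ be the graph polynomial of $G$, a polynomial with integer coefficients whose variables are the vertices of $G$, where $<$ fixes an arbitrary orientation of the edges of $G$ (changing the orientation changes $P(G)$ only by a sign). A monomial is called non-vanishing in $P(G)$ if its coefficient in $P(G)$ is nonzero. Then: (i) there is no non-vanishing monomial in $P(G)$ of the form $x^0y^0\prod_{i=1}^n v_i^{\alpha_i}$ with $\alpha_i\le 2$ for all $i$; (ii) there is a non-vanishing monomial in $P(G)$ of the form $x^1y^0\prod_{i=1}^n v_i^{\alpha_i}$ with $\alpha_i\le 2$ for all $i$ if and only if $C(x)\ne C(y)$; (iii) there is a non-vanishing monomial in $P(G)$ of the form $x^\beta y^\gamma\prod_{i=1}^n v_i^{\alpha_i}$ with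 $\beta,\gamma\le 1$ and $\alpha_i\le 2$ for all $i$. -/

import Mathlib

namespace SimpleGraph

variable {V : Type*}

/-- A graph is `2`-connected if it is connected, has at least three vertices, and has no cutvertex. -/
structure IsTwoConnected (G : SimpleGraph V) : Prop where
  three_le_card : 3 ≤ Nat.card V
  connected : G.Connected
  connected_delete : ∀ v : V, (G.induce {v}ᶜ).Connected

/-- A rotation system of `G`: for every vertex, a cyclic order of the darts (oriented edges) that
leave it, given as one permutation of the darts whose cycles are the sets of darts with a common
tail. It records the clockwise order of the edges around each vertex in a drawing of `G` on an
oriented surface. -/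
structure RotationSystem (G : SimpleGraph V) where
  next : Equiv.Perm G.Dart
  fst_next : ∀ d, (next d).fst = d.fst
  sameCycle_of_fst_eq : ∀ d d', d.fst = d'.fst → next.SameCycle d d'

namespace RotationSystem

variable {G : SimpleGraph V}

/-- The face-tracing permutation: run along the dart `d`, then leave its head by the dart that
follows the reversal of `d` in the cyclic order at that head. -/
def facePerm (R : RotationSystem G) : Equiv.Perm G.Dart :=
  (Dart.symm_involutive (G := G)).toPerm.trans R.next

/-- The faces of a rotation system of a connected graph with at least one edge: the cycles of the
face-tracing permutation. -/
def Face (R : RotationSystem G) : Type _ :=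
  Quotient (Equiv.Perm.SameCycle.setoid R.facePerm)

/-- The face that is traced by the dart `d`. -/
def faceOf (R : RotationSystem G) (d : G.Dart) : R.Face :=
  Quotient.mk (Equiv.Perm.SameCycle.setoid R.facePerm) d

/-- The darts on the boundary walk of the face `f`. -/
def boundary (R : RotationSystem G) (f : R.Face) : Set G.Dart :=
  {d | R.faceOf d = f}

end RotationSystem

/-- An embedding in the plane of a connected graph `G` with at least one edge, up to
homeomorphism: a rotation system of `G` whose surface is the sphere, that is, which satisfies
Euler's formula `|V| - |E| + |F| = 2`, together with the choice of the outer face. -/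
structure PlaneEmbedding (G : SimpleGraph V) extends RotationSystem G where
  outer : toRotationSystem.Face
  euler : (Nat.card V : ℤ) - Nat.card G.edgeSet + Nat.card toRotationSystem.Face = 2

namespace PlaneEmbedding

variable {G : SimpleGraph V}

/-- Every vertex lies on the boundary of the outer face. -/
def IsOuterplane (E : PlaneEmbedding G) : Prop :=
  ∀ v : V, ∃ d ∈ E.boundary E.outer, d.fst = v

/-- Every face except possibly the outer one is a triangle. (A face boundary with three darts in a
simple graph is a triangle, as consecutive darts are adjacent.) -/
def IsNearTriangulation (E : PlaneEmbedding G) : Prop :=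
  ∀ f : E.Face, f ≠ E.outer → (E.boundary f).ncard = 3

end PlaneEmbedding

/-- An orientation of `G`: a choice of one of the two darts of every edge. -/
structure EdgeOrientation (G : SimpleGraph V) where
  dart : G.edgeSet → G.Dart
  edge_dart : ∀ e, (dart e).edge = e

open Classical in
/-- The graph polynomial `∏ (u - v)`, over all edges `uv` of `G`, oriented from `u` to `v`. -/
noncomputable def graphPolynomial [Fintype V] (G : SimpleGraph V) (o : EdgeOrientation G) :
    MvPolynomial V ℤ :=
  ∏ e : G.edgeSet, (MvPolynomial.X (o.dart e).fst - MvPolynomial.X (o.dart e).snd)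

end SimpleGraph

namespace SimpleGraph

variable {V : Type*} {G : SimpleGraph V}

/-! ### Propagation along connected graphs, and darts of an orientation. -/

/-- A function that agrees on the ends of every edge of a connected graph is constant. -/
lemma Connected.apply_eq_of_forall_adj {α : Type*} (h : G.Connected) (p : V → α)
    (hp : ∀ u v, G.Adj u v → p u = p v) (u v : V) : p u = p v := by
  obtain ⟨w⟩ := h u v
  induction w with
  | nil => rfl
  | cons hadj _ ih => exact (hp _ _ hadj).trans ih

/-- A function on the darts of a connected graph that is constant on the darts leaving any given
vertex and invariant under reversal is constant. -/
lemma Connected.dart_apply_eq {α : Type*} (h : G.Connected) (g : G.Dart → α)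
    (hfst : ∀ d d' : G.Dart, d.fst = d'.fst → g d = g d') (hsymm : ∀ d, g d.symm = g d)
    (d d' : G.Dart) : g d = g d' := by
  -- Passing to sets of values reduces the claim to the vertex version.
  have key : ∀ u v, G.Adj u v → {a | ∃ e : G.Dart, e.fst = u ∧ g e = a} =
      {a | ∃ e : G.Dart, e.fst = v ∧ g e = a} := by
    intro u v huv
    let e₀ : G.Dart := ⟨(u, v), huv⟩
    ext a
    constructor
    · rintro ⟨e, he, rfl⟩
      exact ⟨e₀.symm, rfl, (hsymm e₀).trans (hfst _ _ he.symm)⟩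
    · rintro ⟨e, he, rfl⟩
      exact ⟨e₀, rfl, (hsymm e₀).symm.trans (hfst _ _ he.symm)⟩
  have := h.apply_eq_of_forall_adj _ key d.fst d'.fst
  have hd : g d ∈ {a | ∃ e : G.Dart, e.fst = d.fst ∧ g e = a} := ⟨d, rfl, rfl⟩
  rw [this] at hd
  obtain ⟨e, he, hge⟩ := hd
  rw [← hge, hfst _ _ he]

instance [Finite V] : Finite G.Dart :=
  Finite.of_injective Dart.toProd fun _ _ => Dart.ext _ _

namespace EdgeOrientation

/-- Every dart is the chosen dart of its edge or the reversal of it. -/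
lemma sum_dart_bijective (o : EdgeOrientation G) :
    Function.Bijective (Sum.elim o.dart fun e => (o.dart e).symm) := by
  have hinj : Function.Injective o.dart := fun e e' h => by
    apply Subtype.ext
    rw [← o.edge_dart e, ← o.edge_dart e', h]
  have hne : ∀ e e', o.dart e ≠ (o.dart e').symm := fun e e' h => by
    have : e = e' := by
      apply Subtype.ext
      rw [← o.edge_dart e, ← o.edge_dart e', h, Dart.edge_symm]
    subst this
    exact (o.dart e).symm_ne h.symm
  constructor
  · rintro (e | e) (e' | e') h
    · exact congrArg _ (hinj h)
    · exact absurd h (hne _ _)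
    · exact absurd h.symm (hne _ _)
    · exact congrArg _ (hinj (Dart.symm_involutive.injective h))
  · intro d
    have := o.edge_dart ⟨d.edge, d.edge_mem⟩
    rcases (dart_edge_eq_iff _ _).1 this with h | h
    · exact ⟨Sum.inl _, h⟩
    · exact ⟨Sum.inr ⟨d.edge, d.edge_mem⟩, by simp [h]⟩

lemma sum_dart [Fintype G.Dart] [Fintype G.edgeSet] {M : Type*} [AddCommMonoid M]
    (o : EdgeOrientation G) (F : G.Dart → M) :
    ∑ d, F d = ∑ e, (F (o.dart e) + F (o.dart e).symm) := by
  rw [← (Equiv.ofBijective _ o.sum_dart_bijective).sum_comp, Fintype.sum_sum_type,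
    Finset.sum_add_distrib]
  rfl

lemma card_dart [Finite G.edgeSet] (o : EdgeOrientation G) :
    Nat.card G.Dart = 2 * Nat.card G.edgeSet := by
  rw [← Nat.card_congr (Equiv.ofBijective _ o.sum_dart_bijective), Nat.card_sum, two_mul]

end EdgeOrientation

/-! ### Faces and the cohomology of the sphere. -/

namespace RotationSystem

variable (R : RotationSystem G)

lemma facePerm_apply (d : G.Dart) : R.facePerm d = R.next d.symm := rfl

lemma fst_facePerm (d : G.Dart) : (R.facePerm d).fst = d.snd := R.fst_next d.symm

lemma faceOf_eq_iff {d d' : G.Dart} :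
    R.faceOf d = R.faceOf d' ↔ R.facePerm.SameCycle d d' := Quotient.eq

lemma faceOf_facePerm (d : G.Dart) : R.faceOf (R.facePerm d) = R.faceOf d := by
  rw [faceOf_eq_iff, Equiv.Perm.sameCycle_apply_left]

lemma faceOf_surjective : Function.Surjective R.faceOf := Quotient.mk_surjective

instance [Finite G.Dart] : Finite R.Face := Finite.of_surjective _ R.faceOf_surjective

/-- A function on the faces that agrees on the two sides of every edge is constant. -/
lemma face_apply_eq {α : Type*} (hG : G.Connected) (w : R.Face → α)
    (hw : ∀ d : G.Dart, w (R.faceOf d) = w (R.faceOf d.symm)) (f f' : R.Face) : w f = w f' := by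
  obtain ⟨d, rfl⟩ := R.faceOf_surjective f
  obtain ⟨d', rfl⟩ := R.faceOf_surjective f'
  -- `next d` follows `d.symm` on its face, so turning at a vertex amounts to crossing an edge.
  have hnext : ∀ d, w (R.faceOf (R.next d)) = w (R.faceOf d) := fun d => by
    have := R.faceOf_facePerm d.symm
    rw [facePerm_apply, Dart.symm_symm] at this
    rw [this, hw d]
  refine hG.dart_apply_eq (fun d => w (R.faceOf d)) (fun d d' h => ?_) (fun d => (hw d).symm) d d'
  obtain ⟨i, hi⟩ := R.sameCycle_of_fst_eq d d' h
  subst hi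
  have hz : ∀ i : ℤ, w (R.faceOf ((R.next ^ i) d)) = w (R.faceOf d) := by
    intro i
    induction i with
    | zero => simp
    | succ i ih => rw [zpow_add_one, ← ih, ← zpow_add_one, add_comm, zpow_add, zpow_one,
        Equiv.Perm.mul_apply, hnext]
    | pred i ih => rw [← ih, ← hnext, ← Equiv.Perm.mul_apply, ← zpow_one_add]; congr 4; ring
  exact (hz i).symm

end RotationSystem

/-- A space of functions that are all constant is at most one-dimensional. -/
lemma finrank_le_one_of_const {ι K : Type*} [Finite ι] [Field K] (S : Submodule K (ι → K))
    (hS : ∀ w ∈ S, ∀ i j, w i = w j) : Module.finrank K S ≤ 1 := by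
  have : S ≤ Submodule.span K {1} := by
    intro w hw
    rw [Submodule.mem_span_singleton]
    rcases isEmpty_or_nonempty ι with h | ⟨⟨i⟩⟩
    · exact ⟨0, Subsingleton.elim _ _⟩
    · exact ⟨w i, funext fun j => by simp [hS w hw i j]⟩
  exact (Submodule.finrank_mono this).trans (by
    simpa using finrank_span_le_card (R := K) {(1 : ι → K)})

/-- On the sphere, an antisymmetric function on the darts that sums to zero around every face is
the gradient of a potential. -/
theorem RotationSystem.exists_potential [Fintype V] [Fintype G.Dart] {K : Type*} [Field K]
    (R : RotationSystem G) [DecidableEq R.Face] (o : EdgeOrientation G) (hG : G.Connected)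
    (heuler : (Nat.card V : ℤ) - Nat.card G.edgeSet + Nat.card R.Face = 2)
    (φ : G.Dart → K) (hφ : ∀ d, φ d.symm = -φ d)
    (hface : ∀ f, ∑ d, (if R.faceOf d = f then φ d else 0) = 0) :
    ∃ p : V → K, ∀ d : G.Dart, φ d = p d.snd - p d.fst := by
  classical
  have := Fintype.ofFinite R.Face
  have := Fintype.ofFinite G.edgeSet
  -- `M` is the signed edge-face incidence matrix and `δ` the coboundary on vertices; the goal is
  -- exactness, range δ = ker Mᵀ.
  let M : Matrix G.edgeSet R.Face K := fun e f =>
    (if R.faceOf (o.dart e) = f then 1 else 0) - (if R.faceOf (o.dart e).symm = f then 1 else 0)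
  have hM_apply : ∀ e f, M e f = (if R.faceOf (o.dart e) = f then 1 else 0) -
    (if R.faceOf (o.dart e).symm = f then 1 else 0) := fun _ _ => rfl
  let δ : (V → K) →ₗ[K] (G.edgeSet → K) :=
    { toFun := fun p e => p (o.dart e).snd - p (o.dart e).fst
      map_add' := fun p q => by ext e; simp; ring
      map_smul' := fun a p => by ext e; simp; ring }
  have hM : ∀ (ψ : G.Dart → K), (∀ d, ψ d.symm = -ψ d) → ∀ f,
      M.transpose.mulVecLin (fun e => ψ (o.dart e)) f =
        ∑ d, (if R.faceOf d = f then ψ d else 0) := by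
    intro ψ hψ f
    rw [o.sum_dart, Matrix.mulVecLin_apply]
    refine Finset.sum_congr rfl fun e _ => ?_
    change M e f * ψ (o.dart e) = _
    rw [hM_apply, hψ]
    split_ifs <;> ring
  have hle : LinearMap.range δ ≤ LinearMap.ker M.transpose.mulVecLin := by
    rintro _ ⟨p, rfl⟩
    rw [LinearMap.mem_ker]
    ext f
    refine (hM (fun d => p d.snd - p d.fst) (fun d => ?_) f).trans ?_
    · simp
    · have h1 : ∑ d, (if R.faceOf d = f then p d.fst else 0) =
          ∑ d, (if R.faceOf d = f then p d.snd else 0) := by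
        rw [← Equiv.sum_comp R.facePerm]
        simp only [R.faceOf_facePerm, R.fst_facePerm]
      have h2 : ∀ d, (if R.faceOf d = f then p d.snd - p d.fst else 0) =
          (if R.faceOf d = f then p d.snd else 0) - (if R.faceOf d = f then p d.fst else 0) := by
        intro d; split_ifs <;> simp
      simp only [h2, Finset.sum_sub_distrib, h1, sub_self, Pi.zero_apply]
  have hδ : Module.finrank K (LinearMap.ker δ) ≤ 1 := by
    refine finrank_le_one_of_const _ fun p hp => hG.apply_eq_of_forall_adj p fun u v huv => ?_
    obtain ⟨e | e, he⟩ := o.sum_dart_bijective.2 ⟨(u, v), huv⟩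
    · have := congrFun (LinearMap.mem_ker.1 hp) e
      simp only [Sum.elim_inl] at he
      simpa [δ, he, sub_eq_zero, eq_comm] using this
    · have := congrFun (LinearMap.mem_ker.1 hp) e
      simp only [Sum.elim_inr] at he
      have he' : o.dart e = Dart.symm ⟨(u, v), huv⟩ := by rw [← he, Dart.symm_symm]
      simpa [δ, he', sub_eq_zero, eq_comm] using this
  have hker : Module.finrank K (LinearMap.ker M.mulVecLin) ≤ 1 := by
    refine finrank_le_one_of_const _ fun w hw => R.face_apply_eq hG w fun d => ?_
    have hval : ∀ e, w (R.faceOf (o.dart e)) = w (R.faceOf (o.dart e).symm) := fun e => by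
      have := congrFun (LinearMap.mem_ker.1 hw) e
      rw [Matrix.mulVecLin_apply] at this
      simpa [Matrix.mulVec, dotProduct, hM_apply, sub_mul, Finset.sum_sub_distrib,
        sub_eq_zero] using this
    obtain ⟨e | e, rfl⟩ := o.sum_dart_bijective.2 d
    · exact hval e
    · simpa using (hval e).symm
  -- The kernel bounds give rank δ ≥ |V| - 1 and rank M ≥ |F| - 1, so dim ker Mᵀ ≤ |E| - |F| + 1 =
  -- |V| - 1 by Euler.
  have hrange : LinearMap.range δ = LinearMap.ker M.transpose.mulVecLin := by
    refine Submodule.eq_of_le_of_finrank_le hle ?_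
    have h1 := δ.finrank_range_add_finrank_ker
    have h2 := M.mulVecLin.finrank_range_add_finrank_ker
    have h3 := M.transpose.mulVecLin.finrank_range_add_finrank_ker
    have h4 : Module.finrank K (LinearMap.range M.transpose.mulVecLin) =
      Module.finrank K (LinearMap.range M.mulVecLin) := M.rank_transpose
    simp only [Module.finrank_fintype_fun_eq_card] at h1 h2 h3
    simp only [Nat.card_eq_fintype_card] at heuler
    omega
  have hmem : (fun e => φ (o.dart e)) ∈ LinearMap.range δ := by
    rw [hrange, LinearMap.mem_ker]
    ext f
    rw [hM φ hφ f, hface f, Pi.zero_apply]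
  obtain ⟨p, hp⟩ := hmem
  have hp' : ∀ e, p (o.dart e).snd - p (o.dart e).fst = φ (o.dart e) := congrFun hp
  refine ⟨p, fun d => ?_⟩
  obtain ⟨e | e, rfl⟩ := o.sum_dart_bijective.2 d
  · exact (hp' e).symm
  · simp [hφ, ← hp' e]

/-- If the deletion of `v` leaves the graph connected, a function on the darts leaving `v` that
only changes across corners of one given face is constant. -/
theorem RotationSystem.eq_of_forall_next [Fintype V] {K : Type*} [Field K]
    (R : RotationSystem G) (o : EdgeOrientation G) (hG : G.Connected)
    (heuler : (Nat.card V : ℤ) - Nat.card G.edgeSet + Nat.card R.Face = 2)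
    (f₀ : R.Face) (v : V) (hv : (G.induce {v}ᶜ).Connected) (g : G.Dart → K)
    (hg : ∀ d, d.fst = v → R.faceOf (R.next d) ≠ f₀ → g (R.next d) = g d)
    (d d' : G.Dart) (hd : d.fst = v) (hd' : d'.fst = v) : g d = g d' := by
  classical
  have := Fintype.ofFinite G.Dart
  have := Fintype.ofFinite R.Face
  -- `φ` is the antisymmetrisation of `g` cut off to the darts leaving `v`.
  let h : G.Dart → K := fun d => if d.fst = v then g d else 0
  let φ : G.Dart → K := fun d => h d - h d.symm
  have hsplit : ∀ f, ∑ d, (if R.faceOf d = f then φ d else 0) =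
      ∑ d, ((if R.faceOf d = f then h (R.facePerm d) else 0) -
        (if R.faceOf d = f then h d.symm else 0)) := by
    intro f
    have h1 : ∑ d, (if R.faceOf d = f then h d else 0) =
        ∑ d, (if R.faceOf d = f then h (R.facePerm d) else 0) := by
      rw [← Equiv.sum_comp R.facePerm]
      simp only [R.faceOf_facePerm]
    rw [Finset.sum_sub_distrib, ← h1, ← Finset.sum_sub_distrib]
    refine Finset.sum_congr rfl fun d _ => ?_
    split_ifs <;> simp [φ]
  -- After reindexing, each term compares consecutive darts at one vertex, and so vanishes except at
  -- corners of `f₀` at `v`.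
  have hne : ∀ f, f ≠ f₀ → ∑ d, (if R.faceOf d = f then φ d else 0) = 0 := by
    intro f hf
    rw [hsplit]
    refine Finset.sum_eq_zero fun d _ => ?_
    split_ifs with hdf
    · have hfst : (R.facePerm d).fst = d.symm.fst := R.fst_facePerm d
      simp only [h, hfst]
      split_ifs with hdv
      · rw [R.facePerm_apply, hg d.symm hdv, sub_self]
        rwa [← R.facePerm_apply, R.faceOf_facePerm, hdf]
      · simp
    · simp
  -- The two darts of an edge cancel, so the sum around `f₀` vanishes as well.
  have htot : ∑ f, ∑ d, (if R.faceOf d = f then φ d else 0) = 0 := by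
    rw [Finset.sum_comm]
    simp only [Finset.sum_ite_eq, Finset.mem_univ, if_true, φ, Finset.sum_sub_distrib]
    rw [sub_eq_zero]
    exact (Equiv.sum_comp (Dart.symm_involutive (G := G)).toPerm h).symm
  have hface : ∀ f, ∑ d, (if R.faceOf d = f then φ d else 0) = 0 := by
    intro f
    by_cases hf : f = f₀
    · subst hf
      rwa [Finset.sum_eq_single f (fun f' _ => hne f') (by simp)] at htot
    · exact hne f hf
  obtain ⟨p, hp⟩ := R.exists_potential o hG heuler φ (fun d => by simp [φ]) hface
  -- `φ` is zero on edges avoiding `v`, so the potential is constant on the graph without `v`.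
  have hconst := hv.apply_eq_of_forall_adj (fun u => p u) (fun u w huw => by
    have := hp ⟨(u.1, w.1), huw⟩
    have hu : u.1 ≠ v := u.2
    have hw : w.1 ≠ v := w.2
    simp only [φ, h, Dart.symm, Prod.swap, hu, hw, if_false, sub_zero] at this
    exact (sub_eq_zero.1 this.symm).symm)
  have hval : ∀ d : G.Dart, d.fst = v → d.snd ≠ v ∧ g d = p d.snd - p v := by
    intro d hd
    have hs : d.snd ≠ v := hd ▸ d.adj.ne'
    refine ⟨hs, ?_⟩
    have := hp d
    rw [hd] at this
    rw [← this]
    simp [φ, h, hd, hs]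
  obtain ⟨h1, h2⟩ := hval d hd
  obtain ⟨h3, h4⟩ := hval d' hd'
  rw [h2, h4, hconst ⟨_, h1⟩ ⟨_, h3⟩]

end SimpleGraph


/-! ### A converse to the Combinatorial Nullstellensatz. -/

namespace MvPolynomial

/-- A polynomial of degree at most `|m|` that is nonzero at exactly one point of a grid with sides
`m i + 1` has a nonzero coefficient at `m`. -/
theorem coeff_ne_zero_of_unique_eval_ne_zero {σ R : Type*} [Fintype σ] [CommRing R] [IsDomain R]
    (P : MvPolynomial σ R) (m : σ →₀ ℕ) (hdeg : P.totalDegree ≤ m.degree)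
    (S : σ → Finset R) (hS : ∀ i, (S i).card = m i + 1) (a : σ → R) (ha : ∀ i, a i ∈ S i)
    (hPa : eval a P ≠ 0) (huniq : ∀ s, (∀ i, s i ∈ S i) → eval s P ≠ 0 → s = a) :
    coeff m P ≠ 0 := by
  classical
  intro hcoeff
  -- On the grid `W` is nonzero only at `a`, and its leading monomial is `m` with coefficient 1.
  let W : MvPolynomial σ R := ∏ i, ∏ b ∈ (S i).erase (a i), (X i - C b)
  have hcard : ∀ i, ((S i).erase (a i)).card = m i := fun i => by
    rw [Finset.card_erase_of_mem (ha i), hS, Nat.add_sub_cancel]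
  have hWdeg : W.totalDegree ≤ m.degree := by
    rw [Finsupp.degree_eq_sum]
    refine (totalDegree_finsetProd _ _).trans (Finset.sum_le_sum fun i _ => ?_)
    refine (totalDegree_finsetProd _ _).trans ?_
    rw [← hcard i, Finset.card_eq_sum_ones]
    refine Finset.sum_le_sum fun b _ => (totalDegree_sub_C_le _ _).trans (totalDegree_X _).le
  have hWcoeff : coeff m W = 1 := by
    -- Any order on the variables will do; it only makes `degLex` available.
    let _ : LinearOrder σ := WellOrderingRel.isWellOrder.linearOrder
    have hmonic : ∀ i, ∀ b ∈ (S i).erase (a i),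
        MonomialOrder.degLex.Monic (X i - C b : MvPolynomial σ R) :=
      fun i b _ => MonomialOrder.degLex.monic_X_sub_C i b
    have hW : MonomialOrder.degLex.Monic W :=
      MonomialOrder.Monic.prod fun i _ => MonomialOrder.Monic.prod (hmonic i)
    have hd : MonomialOrder.degLex.degree W = m := by
      rw [MonomialOrder.degree_prod fun i _ => (MonomialOrder.Monic.prod (hmonic i)).ne_zero]
      have : ∀ i, MonomialOrder.degLex.degree (∏ b ∈ (S i).erase (a i),
          (X i - C b : MvPolynomial σ R)) = Finsupp.single i (m i) := fun i => by
        rw [MonomialOrder.degree_prod fun b hb => (hmonic i b hb).ne_zero]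
        simp [MonomialOrder.degree_X_sub_C, hcard]
      simp only [this]
      exact Finsupp.univ_sum_single m
    rw [← hd]
    exact hW
  have hWa : eval a W ≠ 0 := by
    simp only [W, map_prod, Finset.prod_ne_zero_iff]
    intro i _ b hb
    simpa [sub_eq_zero] using (Finset.ne_of_mem_erase hb).symm
  -- This combination cancels at `a`, hence vanishes on the whole grid, yet keeps a nonzero
  -- coefficient at `m`.
  let Q := C (eval a W) * P - C (eval a P) * W
  have hQ : coeff m Q ≠ 0 := by simpa [Q, hcoeff, hWcoeff] using hPa
  have hQdeg : Q.totalDegree = m.degree := by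
    refine le_antisymm ((totalDegree_sub _ _).trans (max_le ?_ ?_)) ?_
    · exact (totalDegree_mul _ _).trans (by simpa using hdeg)
    · exact (totalDegree_mul _ _).trans (by simpa using hWdeg)
    · exact le_totalDegree (mem_support_iff.2 hQ)
  obtain ⟨s, hs, hsQ⟩ := combinatorial_nullstellensatz_exists_eval_nonzero Q m hQ hQdeg S
    fun i => by rw [hS]; exact Nat.lt_succ_self _
  by_cases hsa : s = a
  · subst hsa
    exact hsQ (by simp [Q, mul_comm])
  · have hsP : eval s P = 0 := by
      by_contra h
      exact hsa (huniq s hs h)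
    have hsW : eval s W = 0 := by
      obtain ⟨i, hi⟩ := Function.ne_iff.1 hsa
      simp only [W, map_prod]
      refine Finset.prod_eq_zero (Finset.mem_univ i) (Finset.prod_eq_zero
        (Finset.mem_erase.2 ⟨hi, hs i⟩) (by simp))
    exact hsQ (by simp [Q, hsP, hsW])

end MvPolynomial

/-! ### Coefficients of the graph polynomial and list colourings. -/

namespace SimpleGraph

variable {V : Type*} {G : SimpleGraph V}

lemma eval_graphPolynomial_ne_zero_iff [Fintype V] (o : EdgeOrientation G) (s : V → ℤ) :
    MvPolynomial.eval s (G.graphPolynomial o) ≠ 0 ↔ ∀ u v, G.Adj u v → s u ≠ s v := by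
  classical
  simp only [graphPolynomial, map_prod, Finset.prod_ne_zero_iff, Finset.mem_univ, true_imp_iff,
    map_sub, MvPolynomial.eval_X, sub_ne_zero]
  constructor
  · intro h u v huv
    obtain ⟨e | e, he⟩ := o.sum_dart_bijective.2 ⟨(u, v), huv⟩
    · have := h e
      simp only [Sum.elim_inl] at he
      rwa [he] at this
    · have := h e
      have he' : o.dart e = Dart.symm ⟨(u, v), huv⟩ := by
        simp only [Sum.elim_inr] at he
        rw [← he, Dart.symm_symm]
      rw [he'] at this
      exact this.symm
  · exact fun h e => h _ _ (o.dart e).adj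

lemma isHomogeneous_graphPolynomial [Fintype V] (o : EdgeOrientation G) :
    (G.graphPolynomial o).IsHomogeneous (Nat.card G.edgeSet) := by
  classical
  rw [graphPolynomial, Nat.card_eq_fintype_card, ← Finset.card_univ, Finset.card_eq_sum_ones]
  exact MvPolynomial.IsHomogeneous.prod _ _ _ fun e _ =>
    (MvPolynomial.isHomogeneous_X _ _).sub (MvPolynomial.isHomogeneous_X _ _)

/-- A non-vanishing monomial yields a proper `3`-colouring from lists longer than its exponents. -/
lemma exists_proper_of_coeff_graphPolynomial_ne_zero [Fintype V] (o : EdgeOrientation G)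
    (m : V →₀ ℕ) (hm : (G.graphPolynomial o).coeff m ≠ 0) (S : V → Finset (ZMod 3))
    (hS : ∀ v, m v < (S v).card) :
    ∃ D : V → ZMod 3, (∀ v, D v ∈ S v) ∧ ∀ u v, G.Adj u v → D u ≠ D v := by
  classical
  have hinj : Function.Injective fun z : ZMod 3 => (z.val : ℤ) :=
    Nat.cast_injective.comp (ZMod.val_injective 3)
  have hom := isHomogeneous_graphPolynomial o
  have hdeg : (G.graphPolynomial o).totalDegree = m.degree := by
    rw [hom.totalDegree (fun h => hm (by rw [h, MvPolynomial.coeff_zero]))]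
    by_contra h
    exact hm (hom.coeff_eq_zero (Ne.symm h))
  obtain ⟨s, hs, hsP⟩ := MvPolynomial.combinatorial_nullstellensatz_exists_eval_nonzero _ m hm hdeg
    (fun v => (S v).image fun z => (z.val : ℤ))
    (fun v => by rw [Finset.card_image_of_injective _ hinj]; exact hS v)
  simp only [Finset.mem_image] at hs
  choose D hD hDs using hs
  refine ⟨D, hD, fun u v huv h => (eval_graphPolynomial_ne_zero_iff o s).1 hsP u v huv ?_⟩
  rw [← hDs u, ← hDs v, h]

/-- If there is exactly one proper `3`-colouring from lists whose sizes exceed the exponents of a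
monomial by one, and the monomial has the right degree, then it is non-vanishing. -/
lemma coeff_graphPolynomial_ne_zero_of_unique [Fintype V] (o : EdgeOrientation G)
    (m : V →₀ ℕ) (hdeg : m.degree = Nat.card G.edgeSet) (S : V → Finset (ZMod 3))
    (hS : ∀ v, (S v).card = m v + 1) (D : V → ZMod 3) (hDS : ∀ v, D v ∈ S v)
    (hD : ∀ u v, G.Adj u v → D u ≠ D v)
    (huniq : ∀ D' : V → ZMod 3, (∀ v, D' v ∈ S v) → (∀ u v, G.Adj u v → D' u ≠ D' v) → D' = D) :
    (G.graphPolynomial o).coeff m ≠ 0 := by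
  classical
  have hinj : Function.Injective fun z : ZMod 3 => (z.val : ℤ) :=
    Nat.cast_injective.comp (ZMod.val_injective 3)
  refine MvPolynomial.coeff_ne_zero_of_unique_eval_ne_zero _ m
    (hdeg ▸ (isHomogeneous_graphPolynomial o).totalDegree_le)
    (fun v => (S v).image fun z => (z.val : ℤ))
    (fun v => by rw [Finset.card_image_of_injective _ hinj, hS]) (fun v => ((D v).val : ℤ))
    (fun v => Finset.mem_image_of_mem _ (hDS v)) ?_ fun s hs hsP => ?_
  · exact (eval_graphPolynomial_ne_zero_iff o _).2 fun u v huv h => hD u v huv (hinj h)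
  · simp only [Finset.mem_image] at hs
    choose D' hD' hs' using hs
    rw [← huniq D' hD' fun u v huv h => (eval_graphPolynomial_ne_zero_iff o s).1 hsP u v huv (by
      rw [← hs' u, ← hs' v, h])]
    exact (funext hs').symm

/-! ### Rigidity of 3-colourings and the number of edges. -/

namespace RotationSystem

variable (R : RotationSystem G)

/-- The boundary walk of a face with three darts closes up after three steps. -/
lemma facePerm_pow_three_of_ncard_eq [Finite V] (d : G.Dart)
    (h : (R.boundary (R.faceOf d)).ncard = 3) :
    R.facePerm (R.facePerm (R.facePerm d)) = d := by
  classical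
  have := Fintype.ofFinite G.Dart
  -- Needed because the support of a cycle misses fixed points.
  have hne : R.facePerm d ≠ d := fun he => by
    have := R.fst_facePerm d
    rw [he] at this
    exact d.adj.ne this
  have hset : R.boundary (R.faceOf d) = ((R.facePerm.cycleOf d).support : Set G.Dart) := by
    ext e
    rw [Finset.mem_coe, Equiv.Perm.mem_support_cycleOf_iff, Equiv.Perm.mem_support,
      boundary, Set.mem_ofPred_eq, R.faceOf_eq_iff]
    exact ⟨fun h => ⟨h.symm, hne⟩, fun h => h.1.symm⟩
  rw [hset, Set.ncard_coe_finset,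
    ← ((Equiv.Perm.isCycle_cycleOf_iff _).2 hne).orderOf] at h
  have h3 := pow_orderOf_eq_one (R.facePerm.cycleOf d)
  rw [h] at h3
  have := Equiv.Perm.cycleOf_pow_apply_self R.facePerm d 3
  rw [h3] at this
  simpa [pow_succ] using this.symm

end RotationSystem

namespace PlaneEmbedding

variable (E : PlaneEmbedding G)

/-- A `2`-connected near-triangulation has at most one proper `3`-colouring up to permutations of
the colours, that is, up to affine maps of `ℤ/3`. -/
theorem IsNearTriangulation.exists_affine [Fintype V] {E : PlaneEmbedding G}
    (htri : E.IsNearTriangulation) (h2 : G.IsTwoConnected) (o : EdgeOrientation G)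
    (C D : V → ZMod 3) (hC : ∀ u v, G.Adj u v → C u ≠ C v) (hD : ∀ u v, G.Adj u v → D u ≠ D v) :
    ∃ a b, a ≠ 0 ∧ ∀ v, D v = a * C v + b := by
  -- `g` is 1 where `C` and `D` step in the same direction along a dart, and -1 where they step in
  -- opposite ones.
  let g : G.Dart → ZMod 3 := fun d => (D d.snd - D d.fst) * (C d.snd - C d.fst)
  -- On a triangle, two bijective colourings differ by an affine map, so the sign is the same on two
  -- of its edges.
  have htriangle : ∀ a b c a' b' c' : ZMod 3, a ≠ b → b ≠ c → c ≠ a → a' ≠ b' → b' ≠ c' →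
      c' ≠ a' → (c' - b') * (c - b) = (a' - b') * (a - b) := by decide
  have hnext : ∀ d, E.faceOf (E.next d) ≠ E.outer → g (E.next d) = g d := by
    intro d hd
    have h1 : E.facePerm d.symm = E.next d := by rw [E.facePerm_apply, Dart.symm_symm]
    have h3 := E.facePerm_pow_three_of_ncard_eq d.symm
      (htri _ (by rwa [← E.faceOf_facePerm, h1]))
    rw [h1] at h3
    have h4 := E.fst_facePerm (E.next d)
    have h5 := E.fst_facePerm (E.facePerm (E.next d))
    rw [h3] at h5
    have hadj : G.Adj (E.next d).snd d.snd := by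
      have := (E.facePerm (E.next d)).adj
      rwa [h4, ← h5] at this
    have hadj' : G.Adj d.fst (E.next d).snd := by
      have := (E.next d).adj
      rwa [E.fst_next] at this
    simp only [g, E.fst_next]
    exact htriangle _ _ _ _ _ _ (hC _ _ d.adj.symm) (hC _ _ hadj') (hC _ _ hadj)
      (hD _ _ d.adj.symm) (hD _ _ hadj') (hD _ _ hadj)
  have hconst := h2.connected.dart_apply_eq g (fun d d' hdd => E.eq_of_forall_next o h2.connected
    E.euler E.outer d.fst (h2.connected_delete _) g (fun d _ => hnext d) d d' rfl hdd.symm)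
    (fun d => by simp only [g, Dart.symm, Prod.swap]; ring)
  obtain ⟨d₀⟩ : Nonempty G.Dart := by
    obtain ⟨f, -⟩ := E.faceOf_surjective E.outer
    exact ⟨f⟩
  have hunit : ∀ a b c d : ZMod 3, c ≠ d → a - b = ((a - b) * (c - d)) * (c - d) := by decide
  have hdiff : ∀ u v, G.Adj u v → D v - D u = g d₀ * (C v - C u) := by
    intro u v huv
    rw [hconst d₀ ⟨(u, v), huv⟩]
    exact hunit _ _ _ _ (hC _ _ huv).symm
  have hshift := h2.connected.apply_eq_of_forall_adj (fun v => D v - g d₀ * C v) fun u v huv => by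
    linear_combination -hdiff u v huv
  refine ⟨g d₀, D d₀.fst - g d₀ * C d₀.fst, ?_, fun v => ?_⟩
  · exact mul_ne_zero (sub_ne_zero.2 (hD _ _ d₀.adj).symm) (sub_ne_zero.2 (hC _ _ d₀.adj).symm)
  · linear_combination hshift v d₀.fst

/-- The outer face of a `2`-connected graph visits every vertex at most once. -/
theorem injOn_fst_boundary_outer [Fintype V] (h2 : G.IsTwoConnected) (o : EdgeOrientation G) :
    Set.InjOn (fun d : G.Dart => d.fst) (E.boundary E.outer) := by
  classical
  intro d hd d' hd' hdd
  by_contra hne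
  have hex : ∃ i : ℕ, (E.next ^ i) d = d' := by
    obtain ⟨i, -, hi⟩ := (E.sameCycle_of_fst_eq d d' hdd).exists_pow_eq'
    exact ⟨i, hi⟩
  -- The darts met when turning from `d` until just before the first arrival at `d'`. The indicator
  -- changes only on entering `d` or `d'`, both at outer corners.
  let A : Set G.Dart := {e | ∃ i < Nat.find hex, (E.next ^ i) d = e}
  let g : G.Dart → ℚ := A.indicator 1
  have hpos : 0 < Nat.find hex := by
    rw [Nat.find_pos]
    simpa using hne
  have hmem : ∀ e, E.faceOf (E.next e) ≠ E.outer → (E.next e ∈ A ↔ e ∈ A) := by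
    intro e he
    constructor
    · rintro ⟨i, hi, hie⟩
      cases i with
      | zero =>
        refine absurd ?_ he
        rw [← hie]
        exact hd
      | succ i =>
        rw [pow_succ', Equiv.Perm.mul_apply] at hie
        exact ⟨i, by omega, E.next.injective hie⟩
    · rintro ⟨i, hi, hie⟩
      have hie' : (E.next ^ (i + 1)) d = E.next e := by
        rw [pow_succ', Equiv.Perm.mul_apply, hie]
      rcases (Nat.succ_le_of_lt hi).lt_or_eq with h | h
      · exact ⟨i + 1, h, hie'⟩
      · refine absurd ?_ he
        rw [← hie', ← Nat.succ_eq_add_one, h, Nat.find_spec hex]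
        exact hd'
  have := E.eq_of_forall_next o h2.connected E.euler E.outer d.fst (h2.connected_delete _) g
    (fun e _ he => by simp only [g, Set.indicator, hmem e he, Pi.one_apply]) d d' rfl hdd.symm
  have hdA : d ∈ A := ⟨0, hpos, rfl⟩
  have hdA' : d' ∉ A := by
    rintro ⟨i, hi, hie⟩
    exact Nat.find_min hex hi hie
  simp [g, hdA, hdA'] at this

/-- A `2`-connected outerplane near-triangulation on `N` vertices has `2N - 3` edges. -/
theorem card_edgeSet_add_three [Fintype V] (h2 : G.IsTwoConnected) (hout : E.IsOuterplane)
    (htri : E.IsNearTriangulation) (o : EdgeOrientation G) :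
    Nat.card G.edgeSet + 3 = 2 * Nat.card V := by
  classical
  have := Fintype.ofFinite G.Dart
  have := Fintype.ofFinite E.Face
  have houter : (E.boundary E.outer).ncard = Nat.card V := by
    rw [← (E.injOn_fst_boundary_outer h2 o).ncard_image, ← Set.ncard_univ]
    congr 1
    exact Set.eq_univ_of_forall hout
  have hsum : Nat.card G.Dart = ∑ f : E.Face, (E.boundary f).ncard := by
    rw [Nat.card_eq_fintype_card, ← Finset.card_univ,
      Finset.card_eq_sum_card_fiberwise (f := E.faceOf) (t := Finset.univ) (by simp)]
    refine Finset.sum_congr rfl fun f _ => ?_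
    rw [← Set.ncard_coe_finset]
    congr 1
    ext d
    simp [RotationSystem.boundary]
  -- This gives 2|E| = |V| + 3(|F| - 1), to be combined with Euler's formula.
  rw [← Finset.add_sum_erase _ _ (Finset.mem_univ E.outer), houter,
    Finset.sum_congr rfl fun f hf => htri f (Finset.ne_of_mem_erase hf), Finset.sum_const,
    Finset.card_erase_of_mem (Finset.mem_univ _), Finset.card_univ, o.card_dart,
    ← Nat.card_eq_fintype_card, smul_eq_mul] at hsum
  have := E.euler
  have hF : 0 < Nat.card E.Face := Nat.card_pos_iff.2 ⟨⟨E.outer⟩, inferInstance⟩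
  omega

end PlaneEmbedding

end SimpleGraph

/-! ### Choice of exponents and lists. -/

theorem corollary6 {V : Type*} [Fintype V] (G : SimpleGraph V) (h2 : G.IsTwoConnected)
    (E : G.PlaneEmbedding) (hout : E.IsOuterplane) (htri : E.IsNearTriangulation)
    (x y : V) (hxy : x ≠ y) (C : G.Coloring (Fin 3)) (o : G.EdgeOrientation) :
    (¬ ∃ m : V →₀ ℕ, m x = 0 ∧ m y = 0 ∧ (∀ v, v ≠ x → v ≠ y → m v ≤ 2) ∧
        (G.graphPolynomial o).coeff m ≠ 0) ∧
    ((∃ m : V →₀ ℕ, m x = 1 ∧ m y = 0 ∧ (∀ v, v ≠ x → v ≠ y → m v ≤ 2) ∧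
        (G.graphPolynomial o).coeff m ≠ 0) ↔ C x ≠ C y) ∧
    (∃ m : V →₀ ℕ, m x ≤ 1 ∧ m y ≤ 1 ∧ (∀ v, v ≠ x → v ≠ y → m v ≤ 2) ∧
        (G.graphPolynomial o).coeff m ≠ 0) := by
  have hforce : ∀ p q : ZMod 3, p ≠ q → (p = 0 ∨ p = 1) → (p = 0 ∨ p = 2) →
      (q = 0 ∨ q = 1) → p = 0 ∧ q = 1 := by
    intro p q hpq hp hp' hq
    have hp0 : p = 0 := hp'.elim id fun h => hp.elim id fun h' =>
      absurd (h'.symm.trans h) (by decide)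
    exact ⟨hp0, hq.resolve_left fun h => hpq (hp0.trans h.symm)⟩
  classical
  obtain ⟨c, hc⟩ : ∃ c : V → ZMod 3, ∀ u v, c u = c v ↔ C u = C v :=
    ⟨fun v => (ZMod.finEquiv 3) (C v), fun _ _ => (ZMod.finEquiv 3).injective.eq_iff⟩
  have hC : ∀ u v, G.Adj u v → c u ≠ c v := fun u v huv h => C.valid huv ((hc u v).1 h)
  have haffine := fun D hD => htri.exists_affine h2 o c D hC hD
  have hcard := E.card_edgeSet_add_three h2 hout htri o
  have hproper : ∀ a b : ZMod 3, a ≠ 0 → ∀ u v, G.Adj u v →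
      a * c u + b ≠ a * c v + b := fun a b ha u v huv h =>
    hC u v huv (mul_left_cancel₀ ha (add_right_cancel h))
  have hlist := fun m hm S hS =>
    SimpleGraph.exists_proper_of_coeff_graphPolynomial_ne_zero o m hm S hS
  have hii : C x ≠ C y → ∃ m : V →₀ ℕ, m x = 1 ∧ m y = 0 ∧ (∀ v, v ≠ x → v ≠ y → m v ≤ 2) ∧
      (G.graphPolynomial o).coeff m ≠ 0 := by
    intro hne
    have hne' : c x - c y ≠ 0 := sub_ne_zero.2 fun h => hne ((hc x y).1 h)
    -- The deficit 3 is split as 1 at `x` and 2 at `y`.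
    let m : V →₀ ℕ := Finsupp.equivFunOnFinite.symm fun v =>
      2 - (if v = x then 1 else 0) - (if v = y then 2 else 0)
    have hm : ∀ v, m v = 2 - (if v = x then 1 else 0) - (if v = y then 2 else 0) := fun _ => rfl
    let a : ZMod 3 := (c x - c y)⁻¹
    refine ⟨m, by simp [hm, hxy], by simp [hm], fun v hvx hvy => by simp [hm, hvx, hvy], ?_⟩
    refine SimpleGraph.coeff_graphPolynomial_ne_zero_of_unique o m ?_
      (fun v => if v = x then {0, 1} else if v = y then {0} else Finset.univ) (fun v => ?_)
      (fun v => a * c v + -(a * c y)) (fun v => ?_)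
      (hproper a _ (inv_ne_zero hne')) fun D hDS hD => ?_
    · have h : ∑ v, (m v + ((if v = x then 1 else 0) + (if v = y then 2 else 0))) =
          ∑ _v : V, 2 := Finset.sum_congr rfl fun v _ => by
        rw [hm]
        by_cases hvx : v = x
        · simp [hvx, hxy]
        · by_cases hvy : v = y <;> simp [hvx, hvy, hxy.symm]
      simp only [Finset.sum_add_distrib, Finset.sum_ite_eq', Finset.mem_univ, if_true,
        Finset.sum_const, Finset.card_univ, smul_eq_mul, ← Finsupp.degree_eq_sum,
        ← Nat.card_eq_fintype_card] at h
      omega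
    · rw [hm]
      by_cases hvx : v = x
      · simp [hvx, hxy]
      · by_cases hvy : v = y <;> simp [hvx, hvy, hxy.symm]
    · by_cases hvx : v = x
      · subst hvx
        have : a * c v + -(a * c y) = 1 := by
          rw [← inv_mul_cancel₀ hne']; ring
        simp [this]
      · by_cases hvy : v = y <;> simp [hvx, hvy, hxy.symm]
    · obtain ⟨a', b', ha', hab⟩ := haffine D hD
      have hDx := hDS x
      have hDy := hDS y
      simp only [if_true, hxy.symm, if_false, Finset.mem_insert, Finset.mem_singleton] at hDx hDy
      rw [hab] at hDx hDy
      -- Since `y` gets 0 and `C x ≠ C y`, the colour of `x` must be 1; this fixes the affine map.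
      have hDx' : a' * (c x - c y) = 1 := by
        rcases hDx with h | h
        · refine absurd ?_ (mul_ne_zero ha' hne')
          linear_combination h - hDy
        · linear_combination h - hDy
      have ha : a' = a := eq_inv_of_mul_eq_one_left hDx'
      funext v
      rw [hab, ← ha]
      linear_combination hDy
  refine ⟨?_, ⟨?_, hii⟩, ?_⟩
  · rintro ⟨m, hmx, hmy, hm, hmP⟩
    obtain ⟨D, hDS, hD⟩ := hlist m hmP
      (fun v => if v = x then {0} else if v = y then {0} else Finset.univ) (fun v => by
        by_cases hvx : v = x
        · simp [hvx, hmx]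
        · by_cases hvy : v = y
          · simp [hvy, hxy.symm, hmy]
          · simpa [hvx, hvy] using Nat.lt_succ_of_le (hm v hvx hvy))
    obtain ⟨D', hDS', hD'⟩ := hlist m hmP
      (fun v => if v = x then {0} else if v = y then {1} else Finset.univ) (fun v => by
        by_cases hvx : v = x
        · simp [hvx, hmx]
        · by_cases hvy : v = y
          · simp [hvy, hxy.symm, hmy]
          · simpa [hvx, hvy] using Nat.lt_succ_of_le (hm v hvx hvy))
    obtain ⟨a, b, ha, hab⟩ := haffine D hD
    obtain ⟨a', b', -, hab'⟩ := haffine D' hD'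
    have h1 := hDS x
    have h2 := hDS y
    have h3 := hDS' x
    have h4 := hDS' y
    simp only [if_true, hxy.symm, if_false, Finset.mem_singleton] at h1 h2 h3 h4
    rw [hab] at h1 h2
    rw [hab'] at h3 h4
    have hCxy : c x = c y :=
      mul_left_cancel₀ ha (by linear_combination h1 - h2)
    rw [hCxy, h4] at h3
    exact one_ne_zero h3
  · rintro ⟨m, hmx, hmy, hm, hmP⟩ hCxy
    -- The list at `x` omits the only colour allowed at `y`.
    obtain ⟨D, hDS, hD⟩ := hlist m hmP
      (fun v => if v = x then {1, 2} else if v = y then {0} else Finset.univ) (fun v => by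
        by_cases hvx : v = x
        · simp only [hvx, hmx, if_true]; decide
        · by_cases hvy : v = y
          · simp [hvy, hxy.symm, hmy]
          · simpa [hvx, hvy] using Nat.lt_succ_of_le (hm v hvx hvy))
    obtain ⟨a, b, -, hab⟩ := haffine D hD
    have h1 := hDS x
    have h2 := hDS y
    have h3 : D x = D y := by rw [hab, hab, (hc x y).2 hCxy]
    simp only [if_true, hxy.symm, if_false, Finset.mem_singleton] at h1 h2
    rw [h3, h2] at h1
    revert h1
    decide
  · by_cases hCxy : C x = C y
    · obtain ⟨z, hxz⟩ : ∃ z, G.Adj x z := by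
        obtain ⟨d, -, hd⟩ := hout x
        exact ⟨d.snd, hd ▸ d.adj⟩
      have hzx : z ≠ x := hxz.ne'
      have hzy : z ≠ y := by
        rintro rfl
        exact C.valid hxz hCxy
      have hne' : c z - c x ≠ 0 := sub_ne_zero.2 (hC _ _ hxz).symm
      have hCxy' : c x = c y := (hc x y).2 hCxy
      let m : V →₀ ℕ := Finsupp.equivFunOnFinite.symm fun v =>
        2 - (if v = x then 1 else 0) - (if v = y then 1 else 0) - (if v = z then 1 else 0)
      have hm : ∀ v, m v = 2 - (if v = x then 1 else 0) - (if v = y then 1 else 0) -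
        (if v = z then 1 else 0) := fun _ => rfl
      let a : ZMod 3 := (c z - c x)⁻¹
      refine ⟨m, by simp [hm, hxy, hzx.symm], by simp [hm, hxy.symm, hzy.symm],
        fun v hvx hvy => by simp [hm, hvx, hvy], ?_⟩
      refine SimpleGraph.coeff_graphPolynomial_ne_zero_of_unique o m ?_
        (fun v => if v = x then {0, 1} else if v = y then {0, 2} else if v = z then {0, 1} else
          Finset.univ) (fun v => ?_)
        (fun v => a * c v + -(a * c x)) (fun v => ?_)
        (hproper a _ (inv_ne_zero hne')) fun D hDS hD => ?_
      · have h : ∑ v, (m v + ((if v = x then 1 else 0) + (if v = y then 1 else 0) +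
            (if v = z then 1 else 0))) = ∑ _v : V, 2 := Finset.sum_congr rfl fun v _ => by
          rw [hm]
          by_cases hvx : v = x
          · simp [hvx, hxy, hzx.symm]
          · by_cases hvy : v = y
            · simp [hvy, hxy.symm, hzy.symm]
            · by_cases hvz : v = z <;> simp [hvx, hvy, hvz, hzx, hzy]
        simp only [Finset.sum_add_distrib, Finset.sum_ite_eq', Finset.mem_univ, if_true,
          Finset.sum_const, Finset.card_univ, smul_eq_mul, ← Finsupp.degree_eq_sum,
          ← Nat.card_eq_fintype_card] at h
        omega
      · rw [hm]
        by_cases hvx : v = x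
        · simp [hvx, hxy, hzx.symm]
        · by_cases hvy : v = y
          · simp only [hvy, hxy.symm, hzy.symm, if_true, if_false]; decide
          · by_cases hvz : v = z <;> simp [hvx, hvy, hvz, hzx, hzy]
      · by_cases hvx : v = x
        · simp [hvx]
        · by_cases hvy : v = y
          · simp [hvy, hxy.symm, hCxy']
          · by_cases hvz : v = z
            · have : a * c z + -(a * c x) = 1 := by
                rw [← inv_mul_cancel₀ hne']; ring
              simp [hvz, hzx, hzy, this]
            · simp [hvx, hvy, hvz]
      · obtain ⟨a', b', ha', hab⟩ := haffine D hD
        have hDx := hDS x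
        have hDy := hDS y
        have hDz := hDS z
        have hDxy : D x = D y := by rw [hab, hab, hCxy']
        have hDxz := hD x z hxz
        simp only [if_true, hxy.symm, hzx, hzy, if_false, Finset.mem_insert,
          Finset.mem_singleton] at hDx hDy hDz
        rw [← hDxy] at hDy
        obtain ⟨hx0, hz1⟩ := hforce _ _ hDxz hDx hDy hDz
        rw [hab] at hx0 hz1
        have ha : a' = a := eq_inv_of_mul_eq_one_left (by linear_combination hz1 - hx0)
        funext v
        rw [hab, ← ha]
        linear_combination hx0
    · obtain ⟨m, hmx, hmy, hm⟩ := hii hCxy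
      exact ⟨m, hmx.le, hmy.le.trans zero_le_one, hm⟩
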